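/- Let $k$ be an algebraically closed field of characteristic $0$, let $R=k[X_1,\dots,X_r]$ act on $\mathcal D=k[x_1,\dots,x_r]$ by differential operators ($X_i*f=\partial f/\partial x_i$), and let $R_d$, $\mathcal D_d$ denote the forms of degree $d$. For a subspace $\mathcal W\subseteq\mathcal D_j$ put $h_{\mathcal W}(d)=\dim_k\,[R/\mathrm{Ann}_R(\mathcal W)]_d$. For a list $Q=(Q_1,\dots,Q_n)$ of non-negative integers with $n\le r$, let $\mathcal M_Q(d)$ be the set of $I=(I_1,\dots,I_r)\in\mathbb Z_{\ge0}^r$ with $I_1+\dots+I_r=d$ and $I_l\le Q_l$ for $l=1,\dots,n$, and let $m_Q(d)=\#\mathcal M_Q(d)$. Given $r,j,s,u$ and lists $P,Q$, let $\mathcal E(C)=\langle f_1,\dots,f_s\rangle\subseteq\mathcal D_j$ with $f_t=\sum_{J\in\mathcal M_P(j)}c_{tJ}x^J$ for $C=(c_{tJ})\in k^{s\,m_P(j)}$, and let $\mathcal F(C')=\langle g_1,\dots,g_u\rangle\subseteq\mathcal D_j$ with $g_t=\sum_{J\in\mathcal M_Q(j)}c'_{tJ}x^J$ for $C'=(c'_{tJ})\in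 k^{u\,m_Q(j)}$. Consider the following six families, depending on non-negative integers $a,b,c,i,s$. - $F_1(a,i,s)$: $r=3$, $j=i+a$, $P=(a-1)$, $Q=(j,j,j)$, $u=1$, $i_f=i+3$; $a\ge4$, $i\ge2a$. - $F_2(a,i,s)$: $r=3$, $j=i+\frac{a-1}2$, $P=(a-1)$, $Q=(j,j,j)$, $u=2$, $i_f=i+2$; $a\ge7$ odd, $i\ge\frac{2a-3+\sqrt{2a^2+8a+7}}2$. - $G_1(a,b,i,s)$: $r=4$, $j=i+ab$, $P=(a-1,b-1)$, $Q=(j,j,j,0)$, $u=1$, $i_f=i+3$; $b\ge a\ge2$, $i\ge ab+1$. - $G_2(a,b,i,s)$: $r=4$, $j=i+\frac{ab}2$, $P=(j,a-1,b-1)$, $Q=(1)$, $u=1$, $i_f=i+2$; $b\ge a\ge2$, $ab$ even, $i\ge\frac{ab}2+2$. - $G_3(a,b,i,s)$: $r=4$, $j=i+m$ where $m$ is the largest integer with $\binom{m+1}2<ab$, $P=(a-1,b-1)$, $Q=(j,j,j,j)$, $u=1$, $i_f=i+2$; $b\ge a\ge2$, $ab\ne\binom N2$ for every integer $N\ge 0$,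 $i\ge a+b-3$, $\frac{ab(2i-a-b+4)}2+\binom{m+3}3\le\binom{i+3}3$. - $H_1(a,b,c,i,s)$: $r=5$, $j=i+abc$, $P=(a-1,b-1,c-1)$, $Q=(j,j,j,0,0)$, $u=1$, $i_f=i+3$; $c\ge b\ge a\ge2$, $i\ge abc$. In every family $s$ is also required to satisfy $s\,m_P(j-i_f)\ge m_P(i_f)$. **Theorem.** For any member of any of the six families there are dense Zariski-open sets $U\subseteq k^{s\,m_P(j)}$ and $U'\subseteq k^{u\,m_Q(j)}$ such that for all $C\in U$ and $C'\in U'$: 1. $\mathcal E(C)\cap\mathcal F(C')=\{0\}$; 2. $h_{\mathcal E(C)\oplus\mathcal F(C')}(d)=h_{\mathcal E(C)}(d)+h_{\mathcal F(C')}(d)$ simultaneously for all integers $d$ with $i\le d\le i_f$. -/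

import Mathlib

open MvPolynomial

namespace LevelAlg

section

variable {k : Type*} [Field k]

/-! ### Polynomials acting as differential operators -/

/-- The operators `∂/∂x_i` on `𝒟 = k[x_1, …, x_r]`, as elements of `End_k(𝒟)`. -/
noncomputable def partialOp (k : Type*) [Field k] {r : ℕ} (i : Fin r) :
    Module.End k (MvPolynomial (Fin r) k) :=
  (pderiv (R := k) i).toLinearMap

theorem partialOp_commute {r : ℕ} (i l : Fin r) :
    Commute (partialOp k i) (partialOp k l) := by
  have h : ⁅pderiv (R := k) i, pderiv (R := k) l⁆ = 0 := by
    apply MvPolynomial.derivation_ext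
    intro t
    rw [Derivation.commutator_apply]
    simp only [pderiv_X, Pi.single_apply]
    split_ifs <;> simp
  refine LinearMap.ext fun f => ?_
  have h2 := congrArg (fun D => D f) h
  simp only [Derivation.commutator_apply, Derivation.coe_zero, Pi.zero_apply] at h2
  exact sub_eq_zero.mp h2

theorem partialOp_pow_pairwise {r : ℕ} (E E' : Fin r → ℕ) :
    ((Finset.univ : Finset (Fin r)) : Set (Fin r)).Pairwise
      fun i l => Commute (partialOp k i ^ E i) (partialOp k l ^ E' l) :=
  fun i _ l _ _ => (partialOp_commute i l).pow_pow (E i) (E' l)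

/-- The operator `∂^E = ∏ i, (∂/∂x_i)^(E_i)` for a multi-index `E`. -/
noncomputable def monomialOp (k : Type*) [Field k] {r : ℕ} (E : Fin r →₀ ℕ) :
    Module.End k (MvPolynomial (Fin r) k) :=
  Finset.univ.noncommProd (fun i => partialOp k i ^ E i) (partialOp_pow_pairwise E E)

theorem monomialOp_zero {r : ℕ} : monomialOp k (0 : Fin r →₀ ℕ) = 1 := by
  unfold monomialOp
  rw [Finset.noncommProd_eq_pow_card _ _ _ 1 (by simp), one_pow]

theorem monomialOp_add {r : ℕ} (E E' : Fin r →₀ ℕ) :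
    monomialOp k (E + E') = monomialOp k E * monomialOp k E' := by
  unfold monomialOp
  rw [← Finset.noncommProd_mul_distrib _ _ (partialOp_pow_pairwise E E)
    (partialOp_pow_pairwise E' E') (partialOp_pow_pairwise E' E)]
  exact Finset.noncommProd_congr rfl (by intro i _; simp [pow_add]) _

/-- The action of `R = k[X_1, …, X_r]` on `𝒟 = k[x_1, …, x_r]` by differential operators:
the `k`-algebra map `R → End_k(𝒟)` that sends `X^E` to `∂^E`. -/
noncomputable def diffOp (k : Type*) [Field k] (r : ℕ) :
    MvPolynomial (Fin r) k →ₐ[k] Module.End k (MvPolynomial (Fin r) k) :=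
  AddMonoidAlgebra.lift k (Module.End k (MvPolynomial (Fin r) k)) (Fin r →₀ ℕ)
    { toFun := fun E => monomialOp k E.toAdd
      map_one' := monomialOp_zero
      map_mul' := fun E E' => monomialOp_add E.toAdd E'.toAdd }

/-- `Ann_R(𝒲) = {F ∈ R | F * f = 0 for all f ∈ 𝒲}`. -/
noncomputable def annIdeal {r : ℕ} (W : Submodule k (MvPolynomial (Fin r) k)) :
    Ideal (MvPolynomial (Fin r) k) where
  carrier := {F | ∀ f ∈ W, diffOp k r F f = 0}
  zero_mem' := by intro f _; simp
  add_mem' := by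
    intro F G hF hG f hf
    simp [hF f hf, hG f hf]
  smul_mem' := by
    intro F G hG f hf
    simp [hG f hf]

/-- The Hilbert function of `A_𝒲 = R / Ann_R(𝒲)`: `h_𝒲(d)` is the dimension of the degree-`d`
part of `A_𝒲`, which is the image of `R_d` in the quotient. -/
noncomputable def hilb {r : ℕ} (W : Submodule k (MvPolynomial (Fin r) k)) (d : ℕ) : ℕ :=
  Module.finrank k
    ((homogeneousSubmodule (Fin r) k d).map (Ideal.Quotient.mkₐ k (annIdeal W)).toLinearMap)

/-! ### Constraints and parameterized families of subspaces -/

/-- A constraint of dimension `n` is a list `Q = (Q_1, …, Q_n)`. The `r`-tuple `I` is constrained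
by `Q` if `I_i ≤ Q_i` for `i = 1, …, n`; coordinates beyond the `n`-th are free. -/
def Constrained {r : ℕ} (Q : List ℕ) (I : Fin r →₀ ℕ) : Prop :=
  ∀ (i : Fin r) (h : (i : ℕ) < Q.length), I i ≤ Q[(i : ℕ)]

open Classical in
/-- `ℳ_Q(d)`: the multi-indexes of dimension `r` and degree `d` that are constrained by `Q`. -/
noncomputable def multiIdx (r : ℕ) (Q : List ℕ) (d : ℕ) : Finset (Fin r →₀ ℕ) :=
  (Finset.univ.finsuppAntidiag d).filter (Constrained Q)

/-- The index set of the coefficients of `s` forms of degree `j` in `r` variables all of whose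
monomials are constrained by `Q`; it has `s * m_Q(j)` elements. -/
abbrev CoeffIdx (r j : ℕ) (Q : List ℕ) (s : ℕ) : Type := Fin s × multiIdx r Q j

/-- The form `f_t(C) = ∑ c_{tJ} x^J`, the sum being over `J ∈ ℳ_Q(j)`. -/
noncomputable def genForm {r j : ℕ} {Q : List ℕ} {s : ℕ} (C : CoeffIdx r j Q s → k) (t : Fin s) :
    MvPolynomial (Fin r) k :=
  ∑ J : multiIdx r Q j, monomial (J : Fin r →₀ ℕ) (C (t, J))

/-- The subspace `⟨f_1(C), …, f_s(C)⟩` of `𝒟_j`. -/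
noncomputable def family {r j : ℕ} {Q : List ℕ} {s : ℕ} (C : CoeffIdx r j Q s → k) :
    Submodule k (MvPolynomial (Fin r) k) :=
  Submodule.span k (Set.range (genForm C))

/-! ### General members -/

/-- Zariski-open subsets of the affine space `k^σ`. -/
def IsZariskiOpen {σ : Type*} (U : Set (σ → k)) : Prop :=
  ∃ I : Ideal (MvPolynomial σ k), U = (zeroLocus k I)ᶜ

/-- Dense Zariski-open subsets of `k^σ`: a property holds for general `C` if it holds for all `C`
in such a set. -/
def IsDenseZariskiOpen {σ : Type*} (U : Set (σ → k)) : Prop :=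
  IsZariskiOpen U ∧ ∀ V : Set (σ → k), IsZariskiOpen V → V.Nonempty → (U ∩ V).Nonempty

end

/-! ### The six families -/

/-- The discrete data of a family: codimension `r`, socle degree `j`, the constraints `P` and `Q`,
the numbers `s` and `u` of generators of `ℰ` and `ℱ`, and the initial and final degrees
`i` and `i_f` of the critical range. -/
structure Datum where
  r : ℕ
  j : ℕ
  P : List ℕ
  Q : List ℕ
  s : ℕ
  u : ℕ
  i : ℕ
  iF : ℕ

/-- `s` is `h_ℰ`-sufficient: the `(j - i_f)`-th cropped matrix of `ℰ`, whose rows are indexed by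
the pairs `(E, t)` with `E ∈ ℳ_P(j - i_f)` and `1 ≤ t ≤ s`, and whose columns are indexed by
`ℳ_P(i_f)`, has at least as many rows as columns. -/
def Datum.Sufficient (D : Datum) : Prop :=
  (multiIdx D.r D.P D.iF).card ≤
    (multiIdx D.r D.P (D.j - D.iF) ×ˢ (Finset.univ : Finset (Fin D.s))).card

def F₁ (a i s : ℕ) : Datum where
  r := 3
  j := i + a
  P := [a - 1]
  Q := [i + a, i + a, i + a]
  s := s
  u := 1
  i := i
  iF := i + 3

def F₂ (a i s : ℕ) : Datum where
  r := 3
  j := i + (a - 1) / 2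
  P := [a - 1]
  Q := [i + (a - 1) / 2, i + (a - 1) / 2, i + (a - 1) / 2]
  s := s
  u := 2
  i := i
  iF := i + 2

def G₁ (a b i s : ℕ) : Datum where
  r := 4
  j := i + a * b
  P := [a - 1, b - 1]
  Q := [i + a * b, i + a * b, i + a * b, 0]
  s := s
  u := 1
  i := i
  iF := i + 3

def G₂ (a b i s : ℕ) : Datum where
  r := 4
  j := i + a * b / 2
  P := [i + a * b / 2, a - 1, b - 1]
  Q := [1]
  s := s
  u := 1
  i := i
  iF := i + 2

/-- Here `m` stands for the largest integer with `(m + 1).choose 2 < a * b`; see `IsFamily`. -/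
def G₃ (a b m i s : ℕ) : Datum where
  r := 4
  j := i + m
  P := [a - 1, b - 1]
  Q := [i + m, i + m, i + m, i + m]
  s := s
  u := 1
  i := i
  iF := i + 2

def H₁ (a b c i s : ℕ) : Datum where
  r := 5
  j := i + a * b * c
  P := [a - 1, b - 1, c - 1]
  Q := [i + a * b * c, i + a * b * c, i + a * b * c, 0, 0]
  s := s
  u := 1
  i := i
  iF := i + 3

/-- `D` belongs to one of the six families, with parameters that satisfy its requirements. -/
inductive IsFamily : Datum → Prop
  | F₁ (a i s : ℕ) (ha : 4 ≤ a) (hi : 2 * a ≤ i) (hs : (F₁ a i s).Sufficient) :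
      IsFamily (F₁ a i s)
  | F₂ (a i s : ℕ) (ha : 7 ≤ a) (hodd : Odd a)
      (hi : (2 * (a : ℝ) - 3 + Real.sqrt (2 * (a : ℝ) ^ 2 + 8 * a + 7)) / 2 ≤ (i : ℝ))
      (hs : (F₂ a i s).Sufficient) :
      IsFamily (F₂ a i s)
  | G₁ (a b i s : ℕ) (ha : 2 ≤ a) (hab : a ≤ b) (hi : a * b + 1 ≤ i)
      (hs : (G₁ a b i s).Sufficient) :
      IsFamily (G₁ a b i s)
  | G₂ (a b i s : ℕ) (ha : 2 ≤ a) (hab : a ≤ b) (heven : Even (a * b)) (hi : a * b / 2 + 2 ≤ i)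
      (hs : (G₂ a b i s).Sufficient) :
      IsFamily (G₂ a b i s)
  | G₃ (a b m i s : ℕ) (hm : IsGreatest {n : ℕ | (n + 1).choose 2 < a * b} m)
      (ha : 2 ≤ a) (hab : a ≤ b) (hbin : ∀ N : ℕ, a * b ≠ N.choose 2)
      (hi : (a : ℤ) + b - 3 ≤ i)
      (hineq : (a : ℚ) * b * (2 * i - a - b + 4) / 2 + ((m + 3).choose 3 : ℚ)
        ≤ ((i + 3).choose 3 : ℚ))
      (hs : (G₃ a b m i s).Sufficient) :
      IsFamily (G₃ a b m i s)
  | H₁ (a b c i s : ℕ) (ha : 2 ≤ a) (hab : a ≤ b) (hbc : b ≤ c) (hi : a * b * c ≤ i)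
      (hs : (H₁ a b c i s).Sufficient) :
      IsFamily (H₁ a b c i s)

end LevelAlg

namespace LevelAlg

section

variable {k : Type*} [Field k]

/-! ### Coefficients of partial derivatives -/

/-! The Hilbert functions add in degree `d` once the annihilators of `ℰ` and `ℱ` together span all
forms of degree `d` (`hilb_sup`). A monomial violating `P` kills every member of `ℰ`, whatever its
coefficients. So it suffices that in degree `i` such monomials represent every form modulo the
annihilator of `ℱ`. The sum of the two annihilators then contains all forms of degree `i`, hence of
every degree `d ≥ i`, and degree `j` forces the intersection to vanish.

This is a rank condition. Take rows `(t, α)` with `α ∈ ℳ_Q(j - i)` and columns `β` of degree `i`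
violating `P`. The entry is, up to a nonzero factor, the coefficient of `x^(α+β)` in `g_t`, or zero
if `α + β` is not allowed by `Q`. A nonsingular square submatrix using all rows gives the conclusion
(`inf_eq_bot_and_hilb_sup_of_det_ne_zero`). This is open in `C'` and imposes nothing on `C`.

For one nonsingular instance, set `c'_{tJ} = T^(w²)`, where `w` is a lexicographic weight, additive
in `J`. With rows in increasing and columns in decreasing order, the exponents are `(x_l + y_m)²`.
By the rearrangement inequality the identity alone attains the least total exponent, so the
determinant is a nonzero polynomial in `T` once all diagonal positions are allowed
(`exists_dense_of_matching`). What remains is counting: enough columns for the rows, and in `G₂`,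
where `Q` is not closed under addition, a check of the matched pairs. -/

theorem diffOp_monomial {r : ℕ} (E : Fin r →₀ ℕ) (c : k) :
    diffOp k r (monomial E c) = c • monomialOp k E := by
  unfold diffOp
  exact AddMonoidAlgebra.lift_single _ _ _

theorem monomialOp_single_one {r : ℕ} (l : Fin r) :
    monomialOp k (Finsupp.single l 1) = partialOp k l := by
  classical
  refine (Finset.noncommProd_erase_mul Finset.univ (Finset.mem_univ l) _
    (partialOp_pow_pairwise _ _)).symm.trans ?_
  refine (congrArg₂ (· * ·) (Finset.noncommProd_eq_pow_card _ _ _ 1 ?_) rfl).trans ?_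
  · intro x hx
    have : l ≠ x := fun h => by simp [h] at hx
    simp [Finsupp.single_eq_of_ne' this]
  · simp

theorem exists_coeff_monomialOp [CharZero k] {r : ℕ} (β : Fin r →₀ ℕ) :
    ∀ α : Fin r →₀ ℕ, ∃ κ : k, κ ≠ 0 ∧
      ∀ f : MvPolynomial (Fin r) k, coeff α (monomialOp k β f) = κ * coeff (α + β) f := by
  induction β using Finsupp.induction_linear with
  | zero => exact fun α => ⟨1, one_ne_zero, fun f => by simp [monomialOp_zero]⟩
  | add β β' h h' =>
    intro α
    obtain ⟨κ, hκ, hf⟩ := h α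
    obtain ⟨κ', hκ', hf'⟩ := h' (α + β)
    refine ⟨κ * κ', mul_ne_zero hκ hκ', fun f => ?_⟩
    rw [monomialOp_add, Module.End.mul_apply, hf, hf', add_assoc, mul_assoc]
  | single l n =>
    induction n with
    | zero => exact fun α => ⟨1, one_ne_zero, fun f => by simp [monomialOp_zero]⟩
    | succ n ih =>
      intro α
      obtain ⟨κ, hκ, hf⟩ := ih α
      -- One more derivative brings down the exponent of `x_l`, a positive integer, hence nonzero in
      -- characteristic zero.
      refine ⟨κ * ((α + Finsupp.single l n) l + 1 : ℕ),
        mul_ne_zero hκ (Nat.cast_ne_zero.mpr (Nat.succ_ne_zero _)), fun f => ?_⟩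
      rw [Finsupp.single_add, monomialOp_add, Module.End.mul_apply, hf, monomialOp_single_one]
      have := coeff_pderiv (i := l) f (α + Finsupp.single l n)
      rw [partialOp, Derivation.coeFn_coe, this, add_assoc]
      push_cast
      ring

/-- The nonzero factor by which `∂^β` multiplies the coefficient that it moves to `x^α`. -/
noncomputable def derivFactor (k : Type*) [Field k] [CharZero k] {r : ℕ} (α β : Fin r →₀ ℕ) : k :=
  (exists_coeff_monomialOp (k := k) β α).choose

theorem derivFactor_ne_zero [CharZero k] {r : ℕ} (α β : Fin r →₀ ℕ) : derivFactor k α β ≠ 0 :=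
  (exists_coeff_monomialOp (k := k) β α).choose_spec.1

theorem coeff_monomialOp [CharZero k] {r : ℕ} (α β : Fin r →₀ ℕ) (f : MvPolynomial (Fin r) k) :
    coeff α (monomialOp k β f) = derivFactor k α β * coeff (α + β) f :=
  (exists_coeff_monomialOp (k := k) β α).choose_spec.2 f

/-! ### Additivity of the Hilbert function -/

theorem annIdeal_sup {r : ℕ} (W W' : Submodule k (MvPolynomial (Fin r) k)) :
    annIdeal (W ⊔ W') = annIdeal W ⊓ annIdeal W' := by
  apply le_antisymm
  · intro F hF
    exact ⟨fun f hf => hF f (Submodule.mem_sup_left hf), fun f hf => hF f (Submodule.mem_sup_right hf)⟩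
  · rintro F ⟨h1, h2⟩ f hf
    obtain ⟨y, hy, z, hz, rfl⟩ := Submodule.mem_sup.mp hf
    rw [map_add, h1 y hy, h2 z hz, add_zero]

theorem mem_annIdeal_span {r : ℕ} {ι : Type*} (f : ι → MvPolynomial (Fin r) k)
    (F : MvPolynomial (Fin r) k) (h : ∀ t, diffOp k r F (f t) = 0) :
    F ∈ annIdeal (Submodule.span k (Set.range f)) := by
  intro g hg
  have : Submodule.span k (Set.range f) ≤ LinearMap.ker (diffOp k r F) := by
    rw [Submodule.span_le]
    rintro _ ⟨t, rfl⟩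
    exact h t
  exact this hg

/-- The annihilator of a sum is the intersection of the annihilators, so the modular dimension
formula applies to their degree-`d` parts, whose sum is everything by `h`. -/
theorem hilb_sup {r : ℕ} (W W' : Submodule k (MvPolynomial (Fin r) k)) (d : ℕ)
    (h : ∀ v ∈ homogeneousSubmodule (Fin r) k d, ∃ a ∈ homogeneousSubmodule (Fin r) k d,
      a ∈ annIdeal W ∧ v - a ∈ annIdeal W') :
    hilb (W ⊔ W') d = hilb W d + hilb W' d := by
  have : Module.Finite k (homogeneousSubmodule (Fin r) k d) :=
    Module.Finite.iff_fg.mpr (homogeneousSubmodule_fg _ _ d)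
  set V := homogeneousSubmodule (Fin r) k d
  let K (W : Submodule k (MvPolynomial (Fin r) k)) : Submodule k V :=
    ((annIdeal W).restrictScalars k).comap V.subtype
  have key (W : Submodule k (MvPolynomial (Fin r) k)) :
      hilb W d + Module.finrank k (K W) = Module.finrank k V := by
    have h1 := LinearMap.finrank_range_add_finrank_ker
      ((Ideal.Quotient.mkₐ k (annIdeal W)).toLinearMap.domRestrict V)
    rw [LinearMap.range_domRestrict] at h1
    have h2 : LinearMap.ker ((Ideal.Quotient.mkₐ k (annIdeal W)).toLinearMap.domRestrict V) = K W := by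
      ext v
      simp [K, Ideal.Quotient.eq_zero_iff_mem]
    rw [h2] at h1
    exact h1
  have hinf : K (W ⊔ W') = K W ⊓ K W' := by
    ext v
    simp [K, annIdeal_sup]
  have hsup : K W ⊔ K W' = ⊤ := by
    rw [eq_top_iff]
    rintro ⟨v, hv⟩ -
    obtain ⟨a, ha, haW, haW'⟩ := h v hv
    rw [Submodule.mem_sup]
    exact ⟨⟨a, ha⟩, haW, ⟨v - a, V.sub_mem hv ha⟩, haW', by ext1; simp⟩
  have hd := Submodule.finrank_sup_add_finrank_inf_eq (K W) (K W')
  rw [hsup, finrank_top, ← hinf] at hd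
  have := key W
  have := key W'
  have := key (W ⊔ W')
  omega

/-! ### Zariski-open sets -/

theorem isDenseZariskiOpen_univ {σ : Type*} : IsDenseZariskiOpen (Set.univ : Set (σ → k)) := by
  refine ⟨⟨⊤, ?_⟩, fun V _ h => by simpa using h⟩
  rw [zeroLocus_top]
  simp

/-- A nonempty open set contains the nonvanishing locus of some `q ≠ 0`, and over an infinite field
`p * q` is nonzero at some point. -/
theorem isDenseZariskiOpen_ne_zero [Infinite k] {σ : Type*} (p : MvPolynomial σ k) (hp : p ≠ 0) :
    IsDenseZariskiOpen {x : σ → k | eval x p ≠ 0} := by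
  refine ⟨⟨Ideal.span {p}, ?_⟩, ?_⟩
  · ext x
    simp [zeroLocus_span, aeval_eq_eval]
  · rintro V ⟨I, rfl⟩ ⟨y, hy⟩
    rw [Set.mem_compl_iff, mem_zeroLocus_iff] at hy
    push Not at hy
    obtain ⟨q, hq, hqy⟩ := hy
    have hq0 : q ≠ 0 := by rintro rfl; simp at hqy
    by_contra hne
    refine mul_ne_zero hp hq0 (MvPolynomial.funext fun x => ?_)
    rw [map_zero, map_mul]
    by_contra hx
    refine hne ⟨x, left_ne_zero_of_mul hx, fun hmem => right_ne_zero_of_mul hx ?_⟩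
    have := (mem_zeroLocus_iff.mp hmem) q hq
    simpa [aeval_eq_eval] using this

end
end LevelAlg

namespace LevelAlg

section

variable {k : Type*} [Field k]

/-! ### Generic forms -/

theorem mem_multiIdx {r : ℕ} {Q : List ℕ} {d : ℕ} {J : Fin r →₀ ℕ} :
    J ∈ multiIdx r Q d ↔ J.degree = d ∧ Constrained Q J := by
  simp [multiIdx, Finset.mem_finsuppAntidiag, Finsupp.degree_eq_sum]

theorem Constrained.mono {r : ℕ} {Q : List ℕ} {I J : Fin r →₀ ℕ} (hJ : Constrained Q J)
    (h : I ≤ J) : Constrained Q I :=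
  fun l hl => (h l).trans (hJ l hl)

theorem coeff_genForm {r j : ℕ} {Q : List ℕ} {s : ℕ} (C : CoeffIdx r j Q s → k) (t : Fin s)
    {K : Fin r →₀ ℕ} (hK : K ∈ multiIdx r Q j) : coeff K (genForm C t) = C (t, ⟨K, hK⟩) := by
  classical
  rw [genForm, coeff_sum, Finset.sum_eq_single ⟨K, hK⟩]
  · simp
  · intro J _ hJ
    rw [coeff_monomial, if_neg fun h => hJ (Subtype.ext h)]
  · simp

theorem coeff_genForm_of_notMem {r j : ℕ} {Q : List ℕ} {s : ℕ} (C : CoeffIdx r j Q s → k)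
    (t : Fin s) {K : Fin r →₀ ℕ} (hK : K ∉ multiIdx r Q j) : coeff K (genForm C t) = 0 := by
  classical
  rw [genForm, coeff_sum]
  refine Finset.sum_eq_zero fun J _ => ?_
  rw [coeff_monomial, if_neg]
  rintro rfl
  exact hK J.2

theorem coeff_eq_zero_of_mem_family {r j : ℕ} {Q : List ℕ} {s : ℕ} {C : CoeffIdx r j Q s → k}
    {f : MvPolynomial (Fin r) k} (hf : f ∈ family C) {K : Fin r →₀ ℕ}
    (hK : K ∉ multiIdx r Q j) : coeff K f = 0 := by
  have : family C ≤ LinearMap.ker (lcoeff k K) := by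
    rw [family, Submodule.span_le]
    rintro _ ⟨t, rfl⟩
    exact coeff_genForm_of_notMem C t hK
  exact this hf

theorem diffOp_apply_eq_sum {r : ℕ} (G f : MvPolynomial (Fin r) k) :
    diffOp k r G f = ∑ γ ∈ G.support, coeff γ G • monomialOp k γ f := by
  conv_lhs => rw [G.as_sum, map_sum, LinearMap.sum_apply]
  simp only [diffOp_monomial, LinearMap.smul_apply]

/-- Each monomial of degree `d + 1` is a variable times one of degree `d`, and ideals absorb the
variable. -/
theorem exists_mem_ideal_succ {r d : ℕ} {I J : Ideal (MvPolynomial (Fin r) k)}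
    (h : ∀ v ∈ homogeneousSubmodule (Fin r) k d, ∃ a ∈ homogeneousSubmodule (Fin r) k d,
      a ∈ I ∧ v - a ∈ J) :
    ∀ v ∈ homogeneousSubmodule (Fin r) k (d + 1),
      ∃ a ∈ homogeneousSubmodule (Fin r) k (d + 1), a ∈ I ∧ v - a ∈ J := by
  intro v hv
  have key : ∀ γ : v.support, ∃ a ∈ homogeneousSubmodule (Fin r) k (d + 1), a ∈ I ∧
      monomial (γ : Fin r →₀ ℕ) (coeff γ v) - a ∈ J := by
    rintro ⟨γ, hγ⟩
    have hdeg : γ.degree = d + 1 := by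
      have := hv (mem_support_iff.mp hγ)
      rwa [Finsupp.degree_eq_weight_one]
    obtain ⟨l, hl⟩ : ∃ l, γ l ≠ 0 := by
      by_contra! hne
      rw [show γ = 0 from Finsupp.ext hne] at hdeg
      simp at hdeg
    have hle : Finsupp.single l 1 ≤ γ := by
      rw [Finsupp.single_le_iff]
      omega
    obtain ⟨δ, rfl⟩ := exists_add_of_le hle
    rw [map_add, Finsupp.degree_single] at hdeg
    obtain ⟨a, ha, haI, haJ⟩ := h (monomial δ (coeff (Finsupp.single l 1 + δ) v))
      (isHomogeneous_monomial _ (by omega))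
    refine ⟨X l * a, ?_, I.mul_mem_left _ haI, ?_⟩
    · rw [mem_homogeneousSubmodule, add_comm]
      exact (isHomogeneous_X k l).mul ha
    · have := J.mul_mem_left (X l) haJ
      rwa [mul_sub, X, monomial_mul, one_mul] at this
  choose a ha haI haJ using key
  refine ⟨∑ γ, a γ, Submodule.sum_mem _ fun γ _ => ha γ, Ideal.sum_mem _ fun γ _ => haI γ, ?_⟩
  have : v = ∑ γ : v.support, monomial (γ : Fin r →₀ ℕ) (coeff γ v) := by
    conv_lhs => rw [v.as_sum]
    exact (Finset.sum_coe_sort v.support fun γ => monomial γ (coeff γ v)).symm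
  nth_rw 1 [this]
  rw [← Finset.sum_sub_distrib]
  exact Ideal.sum_mem _ fun γ _ => haJ γ

/-! ### The contraction pairing between escaping monomials and `ℱ` -/

variable [CharZero k]

theorem monomial_mem_annIdeal_family {r j : ℕ} {P : List ℕ} {s : ℕ} (C : CoeffIdx r j P s → k)
    {γ : Fin r →₀ ℕ} (hγ : ¬ Constrained P γ) (c : k) :
    monomial γ c ∈ annIdeal (family C) := by
  refine mem_annIdeal_span _ _ fun t => ?_
  rw [diffOp_monomial, LinearMap.smul_apply]
  refine smul_eq_zero_of_right _ (MvPolynomial.ext _ _ fun α => ?_)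
  rw [coeff_monomialOp, coeff_genForm_of_notMem, mul_zero, coeff_zero]
  exact fun h => hγ ((mem_multiIdx.mp h).2.mono le_add_self)

/-- A square submatrix of the matrix of the contraction pairing with `F = family C'`: the entry at
`(l, m)` is the coefficient of `∂^(ψ m) f_t` at `x^α`, where `φ l = (t, α)`. -/
noncomputable def pairingMatrix {r j : ℕ} {Q : List ℕ} {u N : ℕ}
    (φ : Fin N → Fin u × (Fin r →₀ ℕ)) (ψ : Fin N → (Fin r →₀ ℕ)) (C' : CoeffIdx r j Q u → k) :
    Matrix (Fin N) (Fin N) k :=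
  Matrix.of fun l m => coeff (φ l).2 (monomialOp k (ψ m) (genForm C' (φ l).1))

/-- Inverting the matrix yields a combination of the monomials `ψ m` acting on every generator of
`ℱ` exactly as `v` does. -/
theorem exists_mem_annIdeal_of_det_ne_zero {r j i p : ℕ} (hj : j = i + p) {P Q : List ℕ}
    {s u N : ℕ} {φ : Fin N → Fin u × (Fin r →₀ ℕ)} {ψ : Fin N → (Fin r →₀ ℕ)}
    (hφ : ∀ t, ∀ α ∈ multiIdx r Q p, ∃ l, φ l = (t, α))
    (hψ : ∀ m, (ψ m).degree = i ∧ ¬ Constrained P (ψ m))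
    (C : CoeffIdx r j P s → k) (C' : CoeffIdx r j Q u → k)
    (hdet : (pairingMatrix φ ψ C').det ≠ 0) {v : MvPolynomial (Fin r) k}
    (hv : v ∈ homogeneousSubmodule (Fin r) k i) :
    ∃ a ∈ homogeneousSubmodule (Fin r) k i,
      a ∈ annIdeal (family C) ∧ v - a ∈ annIdeal (family C') := by
  set M := pairingMatrix φ ψ C'
  let b : Fin N → k := fun l => coeff (φ l).2 (diffOp k r v (genForm C' (φ l).1))
  let h : Fin N → k := M⁻¹.mulVec b
  have hM : M.mulVec h = b := by
    rw [Matrix.mulVec_mulVec, Matrix.mul_nonsing_inv _ (isUnit_iff_ne_zero.mpr hdet),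
      Matrix.one_mulVec]
  have ha : ∑ m, monomial (ψ m) (h m) ∈ homogeneousSubmodule (Fin r) k i :=
    Submodule.sum_mem _ fun m _ => isHomogeneous_monomial _ (hψ m).1
  refine ⟨∑ m, monomial (ψ m) (h m), ha, Ideal.sum_mem _ fun m _ =>
    monomial_mem_annIdeal_family C (hψ m).2 _, mem_annIdeal_span _ _ fun t => ?_⟩
  ext α
  rw [coeff_zero]
  by_cases hα : α ∈ multiIdx r Q p
  · obtain ⟨l, hl⟩ := hφ t α hα
    have h1 := congrFun hM l
    simp only [Matrix.mulVec, dotProduct, b, M, pairingMatrix, Matrix.of_apply, hl] at h1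
    rw [map_sub, LinearMap.sub_apply, coeff_sub, ← h1, map_sum, LinearMap.sum_apply, coeff_sum,
      sub_eq_zero]
    refine Finset.sum_congr rfl fun m _ => ?_
    rw [diffOp_monomial, LinearMap.smul_apply, coeff_smul, smul_eq_mul, mul_comm]
  -- Outside `ℳ_Q(p)` nothing needs solving: if `γ` has degree `i` and `α + γ ∈ ℳ_Q(j)`, then `α ∈
  -- ℳ_Q(p)`.
  · rw [diffOp_apply_eq_sum, coeff_sum]
    refine Finset.sum_eq_zero fun γ hγ => ?_
    rw [coeff_smul, coeff_monomialOp, coeff_genForm_of_notMem, mul_zero, smul_zero]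
    intro hmem
    rw [mem_multiIdx] at hmem
    refine hα (mem_multiIdx.mpr ⟨?_, hmem.2.mono le_self_add⟩)
    have hdeg : γ.degree = i := by
      have := (Submodule.sub_mem _ hv ha) (mem_support_iff.mp hγ)
      rwa [Finsupp.degree_eq_weight_one]
    have := hmem.1
    rw [map_add, hdeg] at this
    omega

theorem inf_eq_bot_and_hilb_sup_of_det_ne_zero {r j i p : ℕ} (hj : j = i + p) {P Q : List ℕ}
    {s u N : ℕ} {φ : Fin N → Fin u × (Fin r →₀ ℕ)} {ψ : Fin N → (Fin r →₀ ℕ)}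
    (hφ : ∀ t, ∀ α ∈ multiIdx r Q p, ∃ l, φ l = (t, α))
    (hψ : ∀ m, (ψ m).degree = i ∧ ¬ Constrained P (ψ m))
    (C : CoeffIdx r j P s → k) (C' : CoeffIdx r j Q u → k)
    (hdet : (pairingMatrix φ ψ C').det ≠ 0) :
    family C ⊓ family C' = ⊥ ∧ ∀ d, i ≤ d →
      hilb (family C ⊔ family C') d = hilb (family C) d + hilb (family C') d := by
  have key : ∀ d, i ≤ d → ∀ v ∈ homogeneousSubmodule (Fin r) k d,
      ∃ a ∈ homogeneousSubmodule (Fin r) k d,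
        a ∈ annIdeal (family C) ∧ v - a ∈ annIdeal (family C') := by
    intro d hd
    induction d, hd using Nat.le_induction with
    | base => exact fun v hv => exists_mem_annIdeal_of_det_ne_zero hj hφ hψ C C' hdet hv
    | succ d _ ih => exact exists_mem_ideal_succ ih
  refine ⟨?_, fun d hd => hilb_sup _ _ d (key d hd)⟩
  rw [eq_bot_iff]
  rintro f ⟨hf, hf'⟩
  rw [Submodule.mem_bot]
  ext K
  rw [coeff_zero]
  by_cases hK : K ∈ multiIdx r P j
  -- In degree `j`, both `a` and `X^K - a` kill `f`, so `∂^K f = 0`, and its constant term is a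
  -- nonzero multiple of the coefficient of `x^K`.
  · obtain ⟨a, -, ha, ha'⟩ := key j (by omega) (monomial K 1)
      (isHomogeneous_monomial _ (mem_multiIdx.mp hK).1)
    have h1 : monomialOp k K f = 0 := by
      have h2 := ha' f hf'
      rwa [map_sub, LinearMap.sub_apply, ha f hf, sub_zero, diffOp_monomial, one_smul] at h2
    have h3 := coeff_monomialOp 0 K f
    rw [h1, coeff_zero, zero_add, eq_comm, mul_eq_zero] at h3
    exact h3.resolve_left (derivFactor_ne_zero _ _)
  · exact coeff_eq_zero_of_mem_family hf hK

/-- If some member of the family `ℱ` has a nonsingular pairing matrix, then general members do. -/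
theorem exists_dense_of_det_ne_zero {r j i p : ℕ} (hj : j = i + p) {P Q : List ℕ}
    {s u N : ℕ} {φ : Fin N → Fin u × (Fin r →₀ ℕ)} {ψ : Fin N → (Fin r →₀ ℕ)}
    (hφ : ∀ t, ∀ α ∈ multiIdx r Q p, ∃ l, φ l = (t, α))
    (hψ : ∀ m, (ψ m).degree = i ∧ ¬ Constrained P (ψ m))
    (C₀ : CoeffIdx r j Q u → k) (hdet : (pairingMatrix φ ψ C₀).det ≠ 0) :
    ∃ (U : Set (CoeffIdx r j P s → k)) (U' : Set (CoeffIdx r j Q u → k)),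
      IsDenseZariskiOpen U ∧ IsDenseZariskiOpen U' ∧ ∀ C ∈ U, ∀ C' ∈ U',
        family C ⊓ family C' = ⊥ ∧ ∀ d, i ≤ d →
          hilb (family C ⊔ family C') d = hilb (family C) d + hilb (family C') d := by
  classical
  -- The pairing matrix with indeterminate coefficients; its determinant cuts out the complement of
  -- `U'`.
  let M : Matrix (Fin N) (Fin N) (MvPolynomial (CoeffIdx r j Q u) k) := Matrix.of fun l m =>
    if h : (φ l).2 + ψ m ∈ multiIdx r Q j then
      C (derivFactor k (φ l).2 (ψ m)) * X ((φ l).1, ⟨(φ l).2 + ψ m, h⟩) else 0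
  have hM (C' : CoeffIdx r j Q u → k) : eval C' M.det = (pairingMatrix φ ψ C').det := by
    rw [RingHom.map_det]
    congr 1
    ext l m
    simp only [RingHom.mapMatrix_apply, Matrix.map_apply, M, Matrix.of_apply, pairingMatrix,
      coeff_monomialOp]
    split_ifs with h
    · simp [coeff_genForm _ _ h]
    · simp [coeff_genForm_of_notMem _ _ h]
  refine ⟨Set.univ, {C' | eval C' M.det ≠ 0}, isDenseZariskiOpen_univ,
    isDenseZariskiOpen_ne_zero _ ?_, fun C _ C' hC' =>
      inf_eq_bot_and_hilb_sup_of_det_ne_zero hj hφ hψ C C' ?_⟩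
  · intro h
    rw [← hM, h, map_zero] at hdet
    exact hdet rfl
  · rwa [← hM]

end
end LevelAlg

namespace LevelAlg

section

variable {k : Type*} [Field k]

/-! ### Nonsingularity by a unique optimal matching -/

/-- Only the identity permutation contributes to the coefficient of the lowest power of `T`, so
off-diagonal factors `κ l m` may vanish. -/
theorem exists_det_mul_pow_ne_zero [Infinite k] {ι : Type*} [Fintype ι] [DecidableEq ι]
    (κ : ι → ι → k) (hκ : ∀ l, κ l l ≠ 0) (w : ι → ι → ℕ)
    (hw : ∀ σ : Equiv.Perm ι, σ ≠ 1 → ∑ l, w l l < ∑ l, w (σ l) l) :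
    ∃ T : k, (Matrix.of fun l m => κ l m * T ^ w l m).det ≠ 0 := by
  let M : Matrix ι ι (Polynomial k) :=
    Matrix.of fun l m => Polynomial.C (κ l m) * Polynomial.X ^ w l m
  have hterm (σ : Equiv.Perm ι) : ∏ l, M (σ l) l =
      Polynomial.C (∏ l, κ (σ l) l) * Polynomial.X ^ ∑ l, w (σ l) l := by
    simp only [M, Matrix.of_apply]
    rw [Finset.prod_mul_distrib, Finset.prod_pow_eq_pow_sum, map_prod]
  have hM : M.det ≠ 0 := by
    intro h0
    have h1 : M.det.coeff (∑ l, w l l) = ∏ l, κ l l := by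
      rw [Matrix.det_apply, Polynomial.finsetSum_coeff, Finset.sum_eq_single 1]
      · rw [hterm, Polynomial.coeff_smul, Polynomial.coeff_C_mul]
        simp
      · intro σ _ hσ
        rw [hterm, Polynomial.coeff_smul, Polynomial.coeff_C_mul, Polynomial.coeff_X_pow,
          if_neg (hw σ hσ).ne, mul_zero, smul_zero]
      · simp
    rw [h0, Polynomial.coeff_zero] at h1
    exact Finset.prod_ne_zero_iff.mpr (fun l _ => hκ l) h1.symm
  by_contra! hT
  refine hM (Polynomial.funext fun T => ?_)
  rw [Polynomial.eval_zero, ← hT T, ← Polynomial.coe_evalRingHom, RingHom.map_det]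
  congr 1
  ext l m
  simp [M]

/-- Expanding the squares, only the cross term depends on `σ`. The rearrangement inequality is
strict unless `σ` is monotone, and then `σ` is the identity. -/
theorem sum_sq_lt_of_strictMono_of_strictAnti {N : ℕ} {x y : Fin N → ℕ} (hx : StrictMono x)
    (hy : StrictAnti y) {σ : Equiv.Perm (Fin N)} (hσ : σ ≠ 1) :
    ∑ l, (x l + y l) ^ 2 < ∑ l, (x (σ l) + y l) ^ 2 := by
  have hanti : Antivary x y := hx.monotone.antivary hy.antitone
  have h1 : ∑ l, x l * y l < ∑ l, x (σ l) * y l := by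
    rw [hanti.sum_mul_lt_sum_comp_perm_mul_iff]
    intro h
    refine hσ ?_
    have hmono : StrictMono σ := by
      intro a b hab
      have h2 := h (hy hab)
      simp only [Function.comp_apply, hx.le_iff_le] at h2
      exact lt_of_le_of_ne h2 (σ.injective.ne hab.ne)
    have h2 : hmono.orderIsoOfSurjective σ σ.surjective = OrderIso.refl _ := Subsingleton.elim _ _
    ext l
    exact congrArg Fin.val (DFunLike.congr_fun h2 l)
  have h2 : ∑ l, x (σ l) ^ 2 = ∑ l, x l ^ 2 := Equiv.sum_comp σ fun l => x l ^ 2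
  have h3 (z : Fin N → ℕ) :
      ∑ l, (z l + y l) ^ 2 = ∑ l, z l ^ 2 + 2 * ∑ l, z l * y l + ∑ l, y l ^ 2 := by
    rw [Finset.mul_sum, ← Finset.sum_add_distrib, ← Finset.sum_add_distrib]
    exact Finset.sum_congr rfl fun l _ => by ring
  have h4 := h3 x
  have h5 := h3 fun l => x (σ l)
  omega

theorem exists_pairingMatrix_det_ne_zero [CharZero k] {r j : ℕ} {Q : List ℕ} {u N : ℕ}
    {φ : Fin N → Fin u × (Fin r →₀ ℕ)} {ψ : Fin N → (Fin r →₀ ℕ)}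
    (A : ℕ) (Λ : (Fin r →₀ ℕ) →+ ℕ)
    (hφ : StrictMono fun l => ((φ l).1 : ℕ) * A + Λ (φ l).2) (hψ : StrictAnti fun m => Λ (ψ m))
    (hdiag : ∀ l, (φ l).2 + ψ l ∈ multiIdx r Q j) :
    ∃ C₀ : CoeffIdx r j Q u → k, (pairingMatrix φ ψ C₀).det ≠ 0 := by
  classical
  obtain ⟨T, hT⟩ := exists_det_mul_pow_ne_zero (k := k)
    (fun l m => if (φ l).2 + ψ m ∈ multiIdx r Q j then derivFactor k (φ l).2 (ψ m) else 0)
    (fun l => by simpa [hdiag l] using derivFactor_ne_zero _ _)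
    (fun l m => (((φ l).1 : ℕ) * A + Λ (φ l).2 + Λ (ψ m)) ^ 2)
    (fun σ hσ => sum_sq_lt_of_strictMono_of_strictAnti hφ hψ hσ)
  -- Additivity of `Λ` splits the weight of `(t, α + β)` into a row part and a column part.
  refine ⟨fun c => T ^ ((c.1 : ℕ) * A + Λ c.2) ^ 2, ?_⟩
  convert hT using 2
  ext l m
  simp only [pairingMatrix, Matrix.of_apply, coeff_monomialOp]
  split_ifs with h
  · rw [coeff_genForm _ _ h, map_add, add_assoc]
  · rw [coeff_genForm_of_notMem _ _ h, mul_zero, zero_mul]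

theorem exists_strictMono_enum {ι : Type*} (s : Finset ι) (f : ι → ℕ) (hf : Set.InjOn f s)
    {N : ℕ} (hN : s.card = N) :
    ∃ φ : Fin N → ι, StrictMono (fun l => f (φ l)) ∧ ∀ a, a ∈ s ↔ ∃ l, φ l = a := by
  classical
  have hcard : (s.image f).card = N := by rw [Finset.card_image_of_injOn hf, hN]
  have hmem (l : Fin N) : ∃ a ∈ s, f a = (s.image f).orderEmbOfFin hcard l :=
    Finset.mem_image.mp ((s.image f).orderEmbOfFin_mem hcard l)
  choose φ hφ hfφ using hmem
  refine ⟨φ, fun l m h => ?_, fun a => ⟨fun ha => ?_, ?_⟩⟩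
  · simpa only [hfφ] using ((s.image f).orderEmbOfFin hcard).strictMono h
  · have h1 : f a ∈ Set.range ((s.image f).orderEmbOfFin hcard) := by
      rw [Finset.range_orderEmbOfFin]
      exact Finset.mem_coe.mpr (Finset.mem_image_of_mem f ha)
    obtain ⟨l, hl⟩ := h1
    exact ⟨l, hf (hφ l) ha ((hfφ l).trans hl)⟩
  · rintro ⟨l, rfl⟩
    exact hφ l

/-! ### Lexicographic weights -/

/-- The exponents of a monomial read as digits in base `B`, the first one most significant. -/
def lexWeight (r B : ℕ) : (Fin r →₀ ℕ) →+ ℕ where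
  toFun K := ∑ l : Fin r, K l.rev * B ^ (l : ℕ)
  map_zero' := by simp
  map_add' K K' := by simp [add_mul, Finset.sum_add_distrib]

theorem lexWeight_eq {r B : ℕ} {K : Fin r →₀ ℕ} (hK : ∀ l, K l < B) :
    lexWeight r B K = finFunctionFinEquiv fun l : Fin r => (⟨K l.rev, hK _⟩ : Fin B) := by
  rw [finFunctionFinEquiv_apply]
  rfl

theorem lexWeight_lt {r B : ℕ} {K : Fin r →₀ ℕ} (hK : ∀ l, K l < B) :
    lexWeight r B K < B ^ r := by
  rw [lexWeight_eq hK]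
  exact Fin.is_lt _

theorem lexWeight_inj {r B : ℕ} {K K' : Fin r →₀ ℕ} (hK : ∀ l, K l < B) (hK' : ∀ l, K' l < B)
    (h : lexWeight r B K = lexWeight r B K') : K = K' := by
  rw [lexWeight_eq hK, lexWeight_eq hK'] at h
  have h1 := finFunctionFinEquiv.injective (Fin.ext h)
  ext l
  simpa using congrArg Fin.val (congrFun h1 l.rev)

/-- Only `K` needs bounded digits: the lower digits of `K'` can only increase its weight. Used in
`G₂` to sort by the first exponent. -/
theorem lexWeight_lt_lexWeight {r B : ℕ} {K K' : Fin (r + 1) →₀ ℕ} (hK : ∀ l, K l < B)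
    (h : K 0 < K' 0) : lexWeight (r + 1) B K < lexWeight (r + 1) B K' := by
  have hsplit (J : Fin (r + 1) →₀ ℕ) : lexWeight (r + 1) B J =
      ∑ l : Fin r, J l.castSucc.rev * B ^ (l : ℕ) + J 0 * B ^ r := by
    simp [lexWeight, Fin.sum_univ_castSucc]
  have h1 : ∑ l : Fin r, K l.castSucc.rev * B ^ (l : ℕ) < B ^ r := by
    have := (finFunctionFinEquiv fun l : Fin r => (⟨K l.castSucc.rev, hK _⟩ : Fin B)).is_lt
    rwa [finFunctionFinEquiv_apply] at this
  rw [hsplit, hsplit]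
  have h2 : (K 0 + 1) * B ^ r ≤ K' 0 * B ^ r := Nat.mul_le_mul_right _ h
  rw [add_mul, one_mul] at h2
  omega

theorem mul_add_lexWeight_inj {r B t t' : ℕ} {K K' : Fin r →₀ ℕ} (hK : ∀ l, K l < B)
    (hK' : ∀ l, K' l < B) (h : t * B ^ r + lexWeight r B K = t' * B ^ r + lexWeight r B K') :
    t = t' ∧ K = K' := by
  have h1 := lexWeight_lt hK
  have h2 := lexWeight_lt hK'
  have ht : t = t' := by
    rcases lt_trichotomy t t' with hlt | heq | hlt
    · have := Nat.mul_le_mul_right (B ^ r) hlt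
      rw [Nat.succ_mul] at this
      omega
    · exact heq
    · have := Nat.mul_le_mul_right (B ^ r) hlt
      rw [Nat.succ_mul] at this
      omega
  subst ht
  exact ⟨rfl, lexWeight_inj hK hK' (by omega)⟩

theorem apply_lt_of_mem_multiIdx {r : ℕ} {Q : List ℕ} {d B : ℕ} {J : Fin r →₀ ℕ}
    (hJ : J ∈ multiIdx r Q d) (hd : d < B) (l : Fin r) : J l < B := by
  have := Finsupp.le_degree l J
  rw [(mem_multiIdx.mp hJ).1] at this
  omega

/-- The general criterion, for a set `S` of columns. Rows and columns are matched in opposite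
lexicographic orders; matched pairs must contribute a nonzero entry. -/
theorem exists_dense_of_matching [CharZero k] {r j i p : ℕ} (hj : j = i + p) {P Q : List ℕ}
    {s u : ℕ} (S : Finset (Fin r →₀ ℕ)) (hS : S ⊆ multiIdx r Q i)
    (hSP : ∀ β ∈ S, ¬ Constrained P β) (hcard : S.card = u * (multiIdx r Q p).card)
    (hdiag : ∀ t : Fin u, ∀ α ∈ multiIdx r Q p, ∀ β ∈ S,
      {ρ ∈ (Finset.univ : Finset (Fin u)) ×ˢ multiIdx r Q p |
        (ρ.1 : ℕ) * (j + 1) ^ r + lexWeight r (j + 1) ρ.2 <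
          t * (j + 1) ^ r + lexWeight r (j + 1) α}.card =
      {β' ∈ S | lexWeight r (j + 1) β < lexWeight r (j + 1) β'}.card →
      α + β ∈ multiIdx r Q j) :
    ∃ (U : Set (CoeffIdx r j P s → k)) (U' : Set (CoeffIdx r j Q u → k)),
      IsDenseZariskiOpen U ∧ IsDenseZariskiOpen U' ∧ ∀ C ∈ U, ∀ C' ∈ U',
        family C ⊓ family C' = ⊥ ∧ ∀ d, i ≤ d →
          hilb (family C ⊔ family C') d = hilb (family C) d + hilb (family C') d := by
  classical
  obtain ⟨φ, hφ, hφR⟩ := exists_strictMono_enum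
    ((Finset.univ : Finset (Fin u)) ×ˢ multiIdx r Q p)
    (fun ρ => (ρ.1 : ℕ) * (j + 1) ^ r + lexWeight r (j + 1) ρ.2) (by
      rintro ⟨t, α⟩ h ⟨t', α'⟩ h' heq
      simp only [Finset.coe_product, Set.mem_prod, Finset.mem_coe] at h h'
      obtain ⟨h1, h2⟩ := mul_add_lexWeight_inj (apply_lt_of_mem_multiIdx h.2 (by omega))
        (apply_lt_of_mem_multiIdx h'.2 (by omega)) heq
      exact Prod.ext (Fin.ext h1) h2) rfl
  obtain ⟨ψ, hψ, hψS⟩ := exists_strictMono_enum S (lexWeight r (j + 1)) (fun β h β' h' heq =>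
      lexWeight_inj (apply_lt_of_mem_multiIdx (hS h) (by omega))
        (apply_lt_of_mem_multiIdx (hS h') (by omega)) heq)
      (N := ((Finset.univ : Finset (Fin u)) ×ˢ multiIdx r Q p).card) (by simp [hcard])
  have hψ' : StrictAnti fun m => lexWeight r (j + 1) (ψ (Fin.rev m)) :=
    fun a b h => hψ (Fin.rev_lt_rev.mpr h)
  have hmemS (m) : ψ m ∈ S := (hψS _).mpr ⟨m, rfl⟩
  have hmemR (l) : (φ l).2 ∈ multiIdx r Q p := by
    simpa using (hφR (φ l)).mpr ⟨l, rfl⟩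
  obtain ⟨C₀, hC₀⟩ := exists_pairingMatrix_det_ne_zero (k := k) (Q := Q) (j := j) _ _ hφ hψ'
    (fun l => by
      refine hdiag (φ l).1 _ (hmemR l) _ (hmemS _) ?_
      -- Row `l` has exactly `l` rows below it and its partner has exactly `l` columns above it,
      -- which is the hypothesis of `hdiag`.
      have h1 : {ρ ∈ (Finset.univ : Finset (Fin u)) ×ˢ multiIdx r Q p |
          (ρ.1 : ℕ) * (j + 1) ^ r + lexWeight r (j + 1) ρ.2 <
            (φ l).1 * (j + 1) ^ r + lexWeight r (j + 1) (φ l).2} = (Finset.Iio l).image φ := by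
        ext ρ
        rw [Finset.mem_filter, hφR, Finset.mem_image]
        constructor
        · rintro ⟨⟨m, rfl⟩, hlt⟩
          exact ⟨m, Finset.mem_Iio.mpr (hφ.lt_iff_lt.mp hlt), rfl⟩
        · rintro ⟨m, hm, rfl⟩
          exact ⟨⟨m, rfl⟩, hφ (Finset.mem_Iio.mp hm)⟩
      have h2 : {β' ∈ S | lexWeight r (j + 1) (ψ l.rev) < lexWeight r (j + 1) β'} =
          (Finset.Iio l).image fun m => ψ m.rev := by
        ext β
        rw [Finset.mem_filter, hψS, Finset.mem_image]
        constructor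
        · rintro ⟨⟨m, rfl⟩, hlt⟩
          exact ⟨m.rev, Finset.mem_Iio.mpr (Fin.rev_lt_iff.mp (hψ.lt_iff_lt.mp hlt)), by simp⟩
        · rintro ⟨m, hm, rfl⟩
          exact ⟨⟨_, rfl⟩, hψ (Fin.rev_lt_rev.mpr (Finset.mem_Iio.mp hm))⟩
      rw [h1, h2, Finset.card_image_of_injective, Finset.card_image_of_injective]
      · exact fun a b h => hψ'.injective (congrArg (lexWeight r (j + 1)) h)
      · exact fun a b h => hφ.injective (by simp [h]))
  refine exists_dense_of_det_ne_zero hj (fun t α hα => (hφR _).mp (by simpa using hα))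
    (fun m => ?_) C₀ hC₀
  exact ⟨(mem_multiIdx.mp (hS (hmemS _))).1, hSP _ (hmemS _)⟩

/-- When the constraints `Q` are closed under sums in the relevant degrees, it is enough that there
are at least as many columns as rows. -/
theorem exists_dense_of_card_le [CharZero k] {r j i p : ℕ} (hj : j = i + p) {P Q : List ℕ}
    {s u : ℕ} (S : Finset (Fin r →₀ ℕ)) (hS : S ⊆ multiIdx r Q i)
    (hSP : ∀ β ∈ S, ¬ Constrained P β) (hcard : u * (multiIdx r Q p).card ≤ S.card)
    (hadd : ∀ α ∈ multiIdx r Q p, ∀ β ∈ multiIdx r Q i, Constrained Q (α + β)) :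
    ∃ (U : Set (CoeffIdx r j P s → k)) (U' : Set (CoeffIdx r j Q u → k)),
      IsDenseZariskiOpen U ∧ IsDenseZariskiOpen U' ∧ ∀ C ∈ U, ∀ C' ∈ U',
        family C ⊓ family C' = ⊥ ∧ ∀ d, i ≤ d →
          hilb (family C ⊔ family C') d = hilb (family C) d + hilb (family C') d := by
  obtain ⟨S', hS', hcard'⟩ := Finset.exists_subset_card_eq hcard
  refine exists_dense_of_matching hj S' (hS'.trans hS) (fun β hβ => hSP β (hS' hβ)) hcard'
    fun t α hα β hβ _ => mem_multiIdx.mpr ⟨?_, hadd α hα β (hS (hS' hβ))⟩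
  rw [map_add, (mem_multiIdx.mp hα).1, (mem_multiIdx.mp (hS (hS' hβ))).1, hj, add_comm]

end
end LevelAlg

namespace LevelAlg

/-! ### Counting multi-indices -/

theorem constrained_nil {r : ℕ} (I : Fin r →₀ ℕ) : Constrained [] I :=
  fun _ h => absurd h (by simp)

theorem constrained_cons {r : ℕ} {q : ℕ} {Q : List ℕ} {I : Fin (r + 1) →₀ ℕ} :
    Constrained (q :: Q) I ↔ I 0 ≤ q ∧ Constrained Q I.tail := by
  constructor
  · intro h
    refine ⟨h 0 (by simp), fun l hl => ?_⟩
    exact h l.succ (by simpa using hl)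
  · rintro ⟨h0, h⟩ l
    refine Fin.cases (fun _ => h0) (fun l hl => ?_) l
    exact h l (by simpa using hl)

theorem card_finsuppAntidiag_univ_fin (n d : ℕ) :
    ((Finset.univ : Finset (Fin (n + 1))).finsuppAntidiag d).card = (d + n).choose n := by
  rw [Finset.card_finsuppAntidiag_nat_eq_choose, Finset.card_univ, Fintype.card_fin,
    show n + 1 + d - 1 = d + n by omega, Nat.choose_symm_add]

theorem two_mul_choose_two (n : ℕ) : 2 * (n + 1).choose 2 = (n + 1) * n := by
  rw [Nat.choose_two_right, Nat.mul_div_cancel' (Nat.even_mul_pred_self _).two_dvd]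
  simp

open Classical in
/-- The multi-indices in `ℳ_Q(d)` that are not constrained by `P`. -/
noncomputable def escapingIdx (r : ℕ) (P Q : List ℕ) (d : ℕ) : Finset (Fin r →₀ ℕ) :=
  {β ∈ multiIdx r Q d | ¬ Constrained P β}

theorem mem_escapingIdx {r : ℕ} {P Q : List ℕ} {d : ℕ} {β : Fin r →₀ ℕ} :
    β ∈ escapingIdx r P Q d ↔ (β.degree = d ∧ Constrained Q β) ∧ ¬ Constrained P β := by
  simp [escapingIdx, mem_multiIdx]

theorem card_le_card_escapingIdx_of_add_single {r p i q : ℕ} {P Q Q' : List ℕ} (l : Fin r)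
    (hi : i = p + q)
    (hQ : ∀ γ : Fin r →₀ ℕ, γ.degree = p → Constrained Q' γ →
      Constrained Q (γ + Finsupp.single l q) ∧ ¬ Constrained P (γ + Finsupp.single l q)) :
    (multiIdx r Q' p).card ≤ (escapingIdx r P Q i).card := by
  refine Finset.card_le_card_of_injOn (· + Finsupp.single l q) (fun γ hγ => ?_)
    fun γ _ γ' _ h => add_right_cancel h
  have hγ' := mem_multiIdx.mp (Finset.mem_coe.mp hγ)
  have := hQ γ hγ'.1 hγ'.2
  exact Finset.mem_coe.mpr (mem_escapingIdx.mpr ⟨⟨by rw [map_add, hγ'.1, Finsupp.degree_single, hi],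
    this.1⟩, this.2⟩)

theorem card_escapingIdx_add {r : ℕ} {P Q : List ℕ} {d : ℕ} :
    ∃ T : Finset (Fin r →₀ ℕ), (escapingIdx r P Q d).card + T.card = (multiIdx r Q d).card ∧
      ∀ β, β ∈ T ↔ (β.degree = d ∧ Constrained Q β) ∧ Constrained P β := by
  classical
  refine ⟨{β ∈ multiIdx r Q d | Constrained P β}, ?_, fun β => by simp [mem_multiIdx]⟩
  rw [escapingIdx, add_comm]
  exact Finset.card_filter_add_card_filter_not _

section

variable {k : Type*} [Field k] [CharZero k]

theorem exists_dense_of_card_le_escapingIdx {r j i p : ℕ} (hj : j = i + p)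
    {P Q : List ℕ} {s u : ℕ}
    (hcard : u * (multiIdx r Q p).card ≤ (escapingIdx r P Q i).card)
    (hadd : ∀ α β : Fin r →₀ ℕ, α.degree = p → β.degree = i → Constrained Q α →
      Constrained Q β → Constrained Q (α + β)) :
    ∃ (U : Set (CoeffIdx r j P s → k)) (U' : Set (CoeffIdx r j Q u → k)),
      IsDenseZariskiOpen U ∧ IsDenseZariskiOpen U' ∧ ∀ C ∈ U, ∀ C' ∈ U',
        family C ⊓ family C' = ⊥ ∧ ∀ d, i ≤ d →
          hilb (family C ⊔ family C') d = hilb (family C) d + hilb (family C') d :=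
  exists_dense_of_card_le hj _ (fun _ hβ => mem_multiIdx.mpr (mem_escapingIdx.mp hβ).1)
    (fun _ hβ => (mem_escapingIdx.mp hβ).2) hcard fun α hα β hβ =>
      hadd α β (mem_multiIdx.mp hα).1 (mem_multiIdx.mp hβ).1 (mem_multiIdx.mp hα).2
        (mem_multiIdx.mp hβ).2

/-! ### The six families -/

theorem exists_dense_F₁ {a i s : ℕ} (ha : 4 ≤ a) (hi : 2 * a ≤ i) :
    ∃ (U : Set (CoeffIdx 3 (i + a) [a - 1] s → k))
      (U' : Set (CoeffIdx 3 (i + a) [i + a, i + a, i + a] 1 → k)),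
      IsDenseZariskiOpen U ∧ IsDenseZariskiOpen U' ∧ ∀ C ∈ U, ∀ C' ∈ U',
        family C ⊓ family C' = ⊥ ∧ ∀ d, i ≤ d →
          hilb (family C ⊔ family C') d = hilb (family C) d + hilb (family C') d := by
  refine exists_dense_of_card_le_escapingIdx rfl ?_ ?_
  · rw [one_mul]
    -- Since `i - a ≥ a`, multiplying by this power of the first variable already violates `P`.
    refine card_le_card_escapingIdx_of_add_single 0 (q := i - a) (by omega) fun γ hd hγ => ?_
    simp [constrained_cons, constrained_nil, Finsupp.degree_eq_sum, Fin.sum_univ_succ,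
      Finsupp.tail_apply] at hd hγ ⊢
    omega
  · intro α β hα hβ h h'
    simp [constrained_cons, constrained_nil, Finsupp.degree_eq_sum, Fin.sum_univ_succ,
      Finsupp.tail_apply] at hα hβ h h' ⊢
    omega

theorem exists_dense_F₂ {a i s : ℕ} (ha : 7 ≤ a) (hodd : Odd a)
    (hi : (2 * (a : ℝ) - 3 + Real.sqrt (2 * (a : ℝ) ^ 2 + 8 * a + 7)) / 2 ≤ (i : ℝ)) :
    ∃ (U : Set (CoeffIdx 3 (i + (a - 1) / 2) [a - 1] s → k))
      (U' : Set (CoeffIdx 3 (i + (a - 1) / 2)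
        [i + (a - 1) / 2, i + (a - 1) / 2, i + (a - 1) / 2] 2 → k)),
      IsDenseZariskiOpen U ∧ IsDenseZariskiOpen U' ∧ ∀ C ∈ U, ∀ C' ∈ U',
        family C ⊓ family C' = ⊥ ∧ ∀ d, i ≤ d →
          hilb (family C ⊔ family C') d = hilb (family C) d + hilb (family C') d := by
  classical
  obtain ⟨p, rfl⟩ := hodd
  have hp : (2 * p + 1 - 1) / 2 = p := by omega
  rw [hp]
  have hsq := Real.sq_sqrt (show (0 : ℝ) ≤ 2 * ((2 * p + 1 : ℕ) : ℝ) ^ 2 +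
    8 * ((2 * p + 1 : ℕ) : ℝ) + 7 by positivity)
  have hs0 := Real.sqrt_nonneg (2 * ((2 * p + 1 : ℕ) : ℝ) ^ 2 + 8 * ((2 * p + 1 : ℕ) : ℝ) + 7)
  have h3 : (3 : ℝ) ≤ Real.sqrt (2 * ((2 * p + 1 : ℕ) : ℝ) ^ 2 + 8 * ((2 * p + 1 : ℕ) : ℝ) + 7) := by
    apply Real.le_sqrt_of_sq_le
    have : (3 : ℝ) ≤ ((2 * p + 1 : ℕ) : ℝ) := by exact_mod_cast (by omega : 3 ≤ 2 * p + 1)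
    nlinarith
  set q := Real.sqrt (2 * ((2 * p + 1 : ℕ) : ℝ) ^ 2 + 8 * ((2 * p + 1 : ℕ) : ℝ) + 7)
  have hia : 2 * p + 1 ≤ i := by
    have : ((2 * p + 1 : ℕ) : ℝ) ≤ i := by linarith
    exact_mod_cast this
  obtain ⟨z, rfl⟩ := Nat.exists_eq_add_of_le' hia
  -- With `a = 2p + 1` and `i = z + a`, the bound on `i` reads `(2z + 3)² ≥ 8(p + 2)(p + 1) + 1`,
  -- and `(2z + 3)² = 4(z + 2)(z + 1) + 1`.
  have hz : (p + 2) * (p + 1) * 2 ≤ (z + 2) * (z + 1) := by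
    have : ((p : ℝ) + 2) * (p + 1) * 2 ≤ (z + 2) * (z + 1) := by
      push_cast at hi hsq
      nlinarith
    exact_mod_cast this
  refine exists_dense_of_card_le_escapingIdx rfl ?_ ?_
  · have hle := card_le_card_escapingIdx_of_add_single (r := 3) (p := z) (q := 2 * p + 1)
      (P := [2 * p + 1 - 1]) (Q := [z + (2 * p + 1) + p, z + (2 * p + 1) + p, z + (2 * p + 1) + p])
      (Q' := []) 0 rfl (fun γ hd hγ => by
        simp [constrained_cons, constrained_nil, Finsupp.degree_eq_sum, Fin.sum_univ_succ,
          Finsupp.tail_apply] at hd hγ ⊢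
        omega)
    refine le_trans ?_ hle
    have h1 : (multiIdx 3 [] z).card = (z + 2).choose 2 := by
      rw [← card_finsuppAntidiag_univ_fin, multiIdx, Finset.filter_true_of_mem]
      exact fun _ _ => constrained_nil _
    have h2 : (multiIdx 3 [z + (2 * p + 1) + p, z + (2 * p + 1) + p, z + (2 * p + 1) + p] p).card ≤
        (p + 2).choose 2 := by
      rw [← card_finsuppAntidiag_univ_fin]
      exact Finset.card_filter_le _ _
    have h4 := two_mul_choose_two (z + 1)
    have h5 := two_mul_choose_two (p + 1)
    simp only [add_assoc, Nat.reduceAdd] at h1 h2 h4 h5 ⊢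
    nlinarith
  · intro α β hα hβ h h'
    simp [constrained_cons, constrained_nil, Finsupp.degree_eq_sum, Fin.sum_univ_succ,
      Finsupp.tail_apply] at hα hβ h h' ⊢
    omega

theorem exists_dense_G₁ {a b i s : ℕ} (ha : 2 ≤ a) (hab : a ≤ b) (hi : a * b + 1 ≤ i) :
    ∃ (U : Set (CoeffIdx 4 (i + a * b) [a - 1, b - 1] s → k))
      (U' : Set (CoeffIdx 4 (i + a * b) [i + a * b, i + a * b, i + a * b, 0] 1 → k)),
      IsDenseZariskiOpen U ∧ IsDenseZariskiOpen U' ∧ ∀ C ∈ U, ∀ C' ∈ U',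
        family C ⊓ family C' = ⊥ ∧ ∀ d, i ≤ d →
          hilb (family C ⊔ family C') d = hilb (family C) d + hilb (family C') d := by
  refine exists_dense_of_card_le_escapingIdx rfl ?_ ?_
  · rw [one_mul]
    obtain ⟨T, hT, hTmem⟩ := card_escapingIdx_add (r := 4) (P := [a - 1, b - 1])
      (Q := [i + a * b, i + a * b, i + a * b, 0]) (d := i)
    -- The last exponent is `0`, so the degree and the first two exponents determine `β`.
    have hTcard : T.card ≤ a * b := by
      rw [← Finset.card_range a, ← Finset.card_range b, ← Finset.card_product]
      refine Finset.card_le_card_of_injOn (fun β => (β 0, β 1)) (fun β hβ => ?_)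
        fun β hβ β' hβ' h => ?_
      · rw [Finset.mem_coe, hTmem] at hβ
        simp [constrained_cons, constrained_nil, Finsupp.degree_eq_sum, Fin.sum_univ_succ,
          Finsupp.tail_apply] at hβ ⊢
        omega
      · rw [Finset.mem_coe, hTmem] at hβ hβ'
        ext l
        simp [constrained_cons, constrained_nil, Finsupp.degree_eq_sum, Fin.sum_univ_succ,
          Finsupp.tail_apply] at hβ hβ' h
        fin_cases l <;> simp <;> omega
    have h1 : (multiIdx 4 [i + a * b, i + a * b, i + a * b, 0] (a * b)).card + a * b ≤
        (multiIdx 4 [i + a * b, i + a * b, i + a * b, 0] i).card := by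
      -- Multiples of the first variable account for the rows, as `i - a * b ≥ 1`; monomials without
      -- it supply the extra `a * b`.
      rw [← Finset.card_filter_add_card_filter_not (s := multiIdx 4 _ i) (fun β => β 0 ≠ 0)]
      refine add_le_add ?_ ?_
      · refine Finset.card_le_card_of_injOn (· + Finsupp.single 0 (i - a * b)) (fun γ hγ => ?_)
          fun γ _ γ' _ h => add_right_cancel h
        rw [Finset.mem_coe, mem_multiIdx] at hγ
        rw [Finset.mem_coe, Finset.mem_filter, mem_multiIdx]
        simp [constrained_cons, constrained_nil, Finsupp.degree_eq_sum, Fin.sum_univ_succ,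
          Finsupp.tail_apply] at hγ ⊢
        omega
      · nth_rw 1 [← Finset.card_range (a * b)]
        refine Finset.card_le_card_of_injOn
          (fun n => Finsupp.single 1 n + Finsupp.single 2 (i - n)) (fun n hn => ?_)
          fun n _ n' _ h => ?_
        · rw [Finset.mem_coe, Finset.mem_range] at hn
          rw [Finset.mem_coe, Finset.mem_filter, mem_multiIdx]
          simp [constrained_cons, constrained_nil, Finsupp.degree_eq_sum, Fin.sum_univ_succ,
            Finsupp.tail_apply, Finsupp.single_apply]
          omega
        · simpa [Finsupp.single_apply] using DFunLike.congr_fun h 1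
    omega
  · intro α β hα hβ h h'
    simp [constrained_cons, constrained_nil, Finsupp.degree_eq_sum, Fin.sum_univ_succ,
      Finsupp.tail_apply] at hα hβ h h' ⊢
    omega

theorem exists_dense_H₁ {a b c i s : ℕ} (ha : 2 ≤ a) (hab : a ≤ b) (hbc : b ≤ c)
    (hi : a * b * c ≤ i) :
    ∃ (U : Set (CoeffIdx 5 (i + a * b * c) [a - 1, b - 1, c - 1] s → k))
      (U' : Set (CoeffIdx 5 (i + a * b * c)
        [i + a * b * c, i + a * b * c, i + a * b * c, 0, 0] 1 → k)),
      IsDenseZariskiOpen U ∧ IsDenseZariskiOpen U' ∧ ∀ C ∈ U, ∀ C' ∈ U',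
        family C ⊓ family C' = ⊥ ∧ ∀ d, i ≤ d →
          hilb (family C ⊔ family C') d = hilb (family C) d + hilb (family C') d := by
  refine exists_dense_of_card_le_escapingIdx rfl ?_ ?_
  · rw [one_mul]
    have h1 : 4 ≤ a * b := by nlinarith
    have h2 : 4 * c ≤ a * b * c := Nat.mul_le_mul_right c h1
    -- The shift may be zero. Escape follows from degree: monomials within `P` have degree at most
    -- `a + b + c - 3 < 4 * c ≤ i` here.
    refine card_le_card_escapingIdx_of_add_single 0 (q := i - a * b * c) (by omega)
      fun γ hd hγ => ?_
    simp [constrained_cons, constrained_nil, Finsupp.degree_eq_sum, Fin.sum_univ_succ,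
      Finsupp.tail_apply] at hd hγ ⊢
    omega
  · intro α β hα hβ h h'
    simp [constrained_cons, constrained_nil, Finsupp.degree_eq_sum, Fin.sum_univ_succ,
      Finsupp.tail_apply] at hα hβ h h' ⊢
    omega

end
end LevelAlg

namespace LevelAlg

/-! ### The families `G₂` and `G₃` -/

theorem sum_sum_sub (c : ℚ) (a b : ℕ) :
    ∑ x ∈ Finset.range a, ∑ y ∈ Finset.range b, (c + 1 - x - y) =
      (a : ℚ) * b * (2 * c - a - b + 4) / 2 := by
  have h1 (e : ℚ) (n : ℕ) : ∑ y ∈ Finset.range n, (e - y) = n * (2 * e - n + 1) / 2 := by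
    induction n with
    | zero => simp
    | succ n ih => rw [Finset.sum_range_succ, ih]; push_cast; ring
  induction a with
  | zero => simp
  | succ a ih => rw [Finset.sum_range_succ, ih, h1]; push_cast; ring

theorem card_filter_multiIdx_one {d e : ℕ} (he : e ≤ 1) :
    {J ∈ multiIdx 4 [1] (d + e) | J 0 = e}.card = (d + 2).choose 2 := by
  rw [← card_finsuppAntidiag_univ_fin]
  refine Finset.card_bij' (fun J _ => J.tail) (fun J _ => J.cons e) (fun J hJ => ?_) (fun J hJ => ?_)
    (fun J hJ => ?_) (fun J hJ => ?_)
  · simp [mem_multiIdx, constrained_cons, constrained_nil, Finsupp.degree_eq_sum,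
      Fin.sum_univ_succ, Finsupp.tail_apply] at hJ ⊢
    omega
  · simp [mem_multiIdx, constrained_cons, constrained_nil, Finsupp.degree_eq_sum,
      Fin.sum_univ_succ (n := 3)] at hJ ⊢
    exact ⟨by rw [← hJ, add_comm], he⟩
  · rw [Finset.mem_filter] at hJ
    rw [← hJ.2, Finsupp.cons_tail]
  · rw [Finsupp.tail_cons]

section

variable {k : Type*} [Field k] [CharZero k]

theorem exists_dense_G₂ {a b i s : ℕ} (ha : 2 ≤ a) (hab : a ≤ b) (heven : Even (a * b))
    (hi : a * b / 2 + 2 ≤ i) :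
    ∃ (U : Set (CoeffIdx 4 (i + a * b / 2) [i + a * b / 2, a - 1, b - 1] s → k))
      (U' : Set (CoeffIdx 4 (i + a * b / 2) [1] 1 → k)),
      IsDenseZariskiOpen U ∧ IsDenseZariskiOpen U' ∧ ∀ C ∈ U, ∀ C' ∈ U',
        family C ⊓ family C' = ⊥ ∧ ∀ d, i ≤ d →
          hilb (family C ⊔ family C') d = hilb (family C) d + hilb (family C') d := by
  classical
  have h4 : 4 ≤ a * b := by nlinarith
  obtain ⟨p, hp⟩ : ∃ p, a * b = 2 * p := heven.two_dvd
  have hp2 : a * b / 2 = p := by omega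
  rw [hp2] at hi ⊢
  obtain ⟨z, rfl⟩ := Nat.exists_eq_add_of_le' hi
  set i := z + (p + 2) with hidef
  set j := i + p with hj
  -- rows and columns, sorted by the exponent of the first variable
  have hrow : (multiIdx 4 [1] p).card =
      {α ∈ multiIdx 4 [1] p | α 0 = 0}.card + {α ∈ multiIdx 4 [1] p | α 0 = 1}.card := by
    rw [← Finset.card_filter_add_card_filter_not (s := multiIdx 4 [1] p) (fun α => α 0 = 0)]
    congr 2
    ext α
    simp [mem_multiIdx, constrained_cons]
    omega
  have hr0 := card_filter_multiIdx_one (d := p) (e := 0) (by omega)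
  have hr1 := card_filter_multiIdx_one (d := p - 1) (e := 1) (by omega)
  have hc0 := card_filter_multiIdx_one (d := i) (e := 0) (by omega)
  have hc1 := card_filter_multiIdx_one (d := i - 1) (e := 1) (by omega)
  rw [Nat.add_zero] at hr0 hc0
  rw [show p - 1 + 1 = p by omega] at hr1
  rw [show i - 1 + 1 = i by omega] at hc1
  let K (e : ℕ) : Finset (Fin 4 →₀ ℕ) :=
    {β ∈ multiIdx 4 [1] i | β 0 = e ∧ ¬ Constrained [j, a - 1, b - 1] β}
  -- With the first exponent fixed, a monomial within `P` is determined by its next two exponents: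
  -- at most `a * b = 2 * p` choices.
  have hK (e : ℕ) : {β ∈ multiIdx 4 [1] i | β 0 = e}.card ≤ (K e).card + 2 * p := by
    rw [← Finset.card_filter_add_card_filter_not (s := {β ∈ multiIdx 4 [1] i | β 0 = e})
      (fun β => ¬ Constrained [j, a - 1, b - 1] β)]
    refine add_le_add (by rw [Finset.filter_filter]) ?_
    rw [← hp, ← Finset.card_range a, ← Finset.card_range b, ← Finset.card_product]
    refine Finset.card_le_card_of_injOn (fun β => (β 1, β 2)) (fun β hβ => ?_)
      fun β hβ β' hβ' h => ?_
    · simp [mem_multiIdx, constrained_cons, constrained_nil, Finsupp.degree_eq_sum,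
        Fin.sum_univ_succ, Finsupp.tail_apply] at hβ ⊢
      omega
    · simp [mem_multiIdx, constrained_cons, constrained_nil, Finsupp.degree_eq_sum,
        Fin.sum_univ_succ, Finsupp.tail_apply] at hβ hβ' h
      ext l
      fin_cases l <;> simp <;> omega
  have hK0 := hK 0
  have hK1 := hK 1
  set N := (multiIdx 4 [1] p).card
  -- `hA` gives enough columns with first exponent `0` to serve all rows with first exponent `1`;
  -- `hB` gives enough columns in total.
  have hA : (p - 1 + 2).choose 2 + 2 * p ≤ (i + 2).choose 2 := by
    have e1 := two_mul_choose_two (p - 1 + 1)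
    have e2 := two_mul_choose_two (i + 1)
    rw [show p - 1 + 1 = p by omega] at e1
    rw [show p - 1 + 2 = p + 1 by omega]
    simp only [add_assoc, Nat.reduceAdd, hidef] at e2 ⊢
    nlinarith
  have hB : (p + 2).choose 2 + (p - 1 + 2).choose 2 + 4 * p ≤
      (i + 2).choose 2 + (i - 1 + 2).choose 2 := by
    have e1 := two_mul_choose_two (p - 1 + 1)
    have e2 := two_mul_choose_two (i + 1)
    have e3 := two_mul_choose_two (i - 1 + 1)
    have e4 := two_mul_choose_two (p + 1)
    rw [show p - 1 + 1 = p by omega] at e1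
    rw [show i - 1 + 1 = i by omega] at e3
    rw [show p - 1 + 2 = p + 1 by omega, show i - 1 + 2 = i + 1 by omega]
    simp only [add_assoc, Nat.reduceAdd, hidef] at e2 e3 e4 ⊢
    nlinarith
  -- Columns with first exponent `0` are always safe, so as many as possible are used.
  obtain ⟨S0, hS0, hS0card⟩ := Finset.exists_subset_card_eq (s := K 0) (min_le_left _ N)
  obtain ⟨S1, hS1, hS1card⟩ := Finset.exists_subset_card_eq (s := K 1) (n := N - S0.card)
    (by omega)
  have hmem0 {β} (hβ : β ∈ S0) := Finset.mem_filter.mp (hS0 hβ)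
  have hmem1 {β} (hβ : β ∈ S1) := Finset.mem_filter.mp (hS1 hβ)
  have hdisj : Disjoint S0 S1 := Finset.disjoint_left.mpr fun β h h' => by
    have := (hmem0 h).2.1
    have := (hmem1 h').2.1
    omega
  refine exists_dense_of_matching hj (S0 ∪ S1) (fun β hβ => ?_) (fun β hβ => ?_) ?_ ?_
  · rcases Finset.mem_union.mp hβ with h | h
    exacts [(hmem0 h).1, (hmem1 h).1]
  · rcases Finset.mem_union.mp hβ with h | h
    exacts [(hmem0 h).2.2, (hmem1 h).2.2]
  · rw [Finset.card_union_of_disjoint hdisj, hS1card]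
    omega
  · intro t α hα β hβ hcard
    have hαm := mem_multiIdx.mp hα
    have hβm : β ∈ multiIdx 4 [1] i := by
      rcases Finset.mem_union.mp hβ with h | h
      exacts [(hmem0 h).1, (hmem1 h).1]
    have hβm' := mem_multiIdx.mp hβm
    refine mem_multiIdx.mpr ⟨by rw [map_add, hαm.1, hβm'.1, add_comm], ?_⟩
    have hα0 := (constrained_cons.mp hαm.2).1
    have hβ0 := (constrained_cons.mp hβm'.2).1
    refine constrained_cons.mpr ⟨?_, constrained_nil _⟩
    by_contra hlt
    rw [Finsupp.add_apply] at hlt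
    have hα1 : α 0 = 1 := by omega
    have hβ1 : β 0 = 1 := by omega
    have hβS1 : β ∈ S1 := by
      refine (Finset.mem_union.mp hβ).resolve_left fun h => ?_
      have := (hmem0 h).2.1
      omega
    -- A matched pair with both first exponents `1` would have all rows of exponent `0` before it,
    -- but fewer than `S1.card` columns above it, and `S1.card` is at most the number of those rows.
    have hlow : {α ∈ multiIdx 4 [1] p | α 0 = 0}.card ≤
        {ρ ∈ (Finset.univ : Finset (Fin 1)) ×ˢ multiIdx 4 [1] p |
          (ρ.1 : ℕ) * (j + 1) ^ 4 + lexWeight 4 (j + 1) ρ.2 <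
            t * (j + 1) ^ 4 + lexWeight 4 (j + 1) α}.card := by
      refine Finset.card_le_card_of_injOn (fun α => ((0 : Fin 1), α)) (fun α' hα' => ?_)
        fun _ _ _ _ h => (Prod.ext_iff.mp h).2
      obtain ⟨hα'm, hα'0⟩ := Finset.mem_filter.mp (Finset.mem_coe.mp hα')
      have : lexWeight 4 (j + 1) α' < lexWeight 4 (j + 1) α :=
        lexWeight_lt_lexWeight (apply_lt_of_mem_multiIdx hα'm (by omega)) (by omega)
      rw [Subsingleton.elim t 0]
      simpa [hα'm] using this
    have hhigh : {β' ∈ S0 ∪ S1 | lexWeight 4 (j + 1) β < lexWeight 4 (j + 1) β'}.card <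
        S1.card := by
      refine Finset.card_lt_card ((Finset.ssubset_iff_of_subset fun β' hβ' => ?_).mpr
        ⟨β, hβS1, by simp⟩)
      rw [Finset.mem_filter, Finset.mem_union] at hβ'
      refine hβ'.1.resolve_left fun h => hβ'.2.not_gt ?_
      have := (hmem0 h).2.1
      exact lexWeight_lt_lexWeight (apply_lt_of_mem_multiIdx (hmem0 h).1 (by omega)) (by omega)
    omega

theorem exists_dense_G₃ {a b m i s : ℕ} (ha : 2 ≤ a) (hab : a ≤ b) (hi : (a : ℤ) + b - 3 ≤ i)
    (hineq : (a : ℚ) * b * (2 * i - a - b + 4) / 2 + ((m + 3).choose 3 : ℚ)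
      ≤ ((i + 3).choose 3 : ℚ)) :
    ∃ (U : Set (CoeffIdx 4 (i + m) [a - 1, b - 1] s → k))
      (U' : Set (CoeffIdx 4 (i + m) [i + m, i + m, i + m, i + m] 1 → k)),
      IsDenseZariskiOpen U ∧ IsDenseZariskiOpen U' ∧ ∀ C ∈ U, ∀ C' ∈ U',
        family C ⊓ family C' = ⊥ ∧ ∀ d, i ≤ d →
          hilb (family C ⊔ family C') d = hilb (family C) d + hilb (family C') d := by
  classical
  refine exists_dense_of_card_le_escapingIdx rfl ?_ ?_
  · rw [one_mul]
    obtain ⟨T, hT, hTmem⟩ := card_escapingIdx_add (r := 4) (P := [a - 1, b - 1])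
      (Q := [i + m, i + m, i + m, i + m]) (d := i)
    have hTcard : T.card ≤ ∑ x ∈ Finset.range a, ∑ y ∈ Finset.range b, (i + 1 - x - y) := by
      have h1 : ∑ x ∈ Finset.range a, ∑ y ∈ Finset.range b, (i + 1 - x - y) =
          ((Finset.range a).sigma fun x => (Finset.range b).sigma fun y =>
            Finset.range (i + 1 - x - y)).card := by
        simp [Finset.card_sigma]
      rw [h1]
      refine Finset.card_le_card_of_injOn (fun β => ⟨β 0, β 1, β 2⟩) (fun β hβ => ?_)
        fun β hβ β' hβ' h => ?_
      · rw [Finset.mem_coe, hTmem] at hβ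
        simp [constrained_cons, constrained_nil, Finsupp.degree_eq_sum, Fin.sum_univ_succ,
          Finsupp.tail_apply] at hβ ⊢
        omega
      · rw [Finset.mem_coe, hTmem] at hβ hβ'
        ext l
        simp [constrained_cons, constrained_nil, Finsupp.degree_eq_sum, Fin.sum_univ_succ,
          Finsupp.tail_apply] at hβ hβ' h
        fin_cases l <;> simp <;> omega
    -- The bound `i ≥ a + b - 3` is just what keeps each `i + 1 - x - y` from truncating.
    have hTQ : (T.card : ℚ) ≤ (a : ℚ) * b * (2 * i - a - b + 4) / 2 := by
      rw [← sum_sum_sub]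
      refine (Nat.cast_le.mpr hTcard).trans (le_of_eq ?_)
      push_cast
      refine Finset.sum_congr rfl fun x hx => Finset.sum_congr rfl fun y hy => ?_
      rw [Finset.mem_range] at hx hy
      rw [Nat.cast_sub (by omega), Nat.cast_sub (by omega)]
      push_cast
      ring
    have h1 : (multiIdx 4 [i + m, i + m, i + m, i + m] i).card = (i + 3).choose 3 := by
      rw [← card_finsuppAntidiag_univ_fin, multiIdx, Finset.filter_true_of_mem]
      intro β hβ
      simp [constrained_cons, constrained_nil, Fin.sum_univ_succ, Finsupp.tail_apply] at hβ ⊢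
      omega
    have h2 : (multiIdx 4 [i + m, i + m, i + m, i + m] m).card ≤ (m + 3).choose 3 := by
      rw [← card_finsuppAntidiag_univ_fin]
      exact Finset.card_filter_le _ _
    have h3 : T.card + (m + 3).choose 3 ≤ (i + 3).choose 3 := by
      have : (T.card : ℚ) + ((m + 3).choose 3 : ℚ) ≤ ((i + 3).choose 3 : ℚ) := by linarith
      exact_mod_cast this
    omega
  · intro α β hα hβ h h'
    simp [constrained_cons, constrained_nil, Finsupp.degree_eq_sum, Fin.sum_univ_succ,
      Finsupp.tail_apply] at hα hβ h h' ⊢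
    omega

end
end LevelAlg

theorem mainTheorem7 {k : Type*} [Field k] [IsAlgClosed k] [CharZero k]
    (D : LevelAlg.Datum) (hD : LevelAlg.IsFamily D) :
    ∃ (U : Set (LevelAlg.CoeffIdx D.r D.j D.P D.s → k))
      (U' : Set (LevelAlg.CoeffIdx D.r D.j D.Q D.u → k)),
      LevelAlg.IsDenseZariskiOpen U ∧ LevelAlg.IsDenseZariskiOpen U' ∧
      ∀ C ∈ U, ∀ C' ∈ U',
        LevelAlg.family C ⊓ LevelAlg.family C' = ⊥ ∧
        ∀ d : ℕ, D.i ≤ d → d ≤ D.iF →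
          LevelAlg.hilb (LevelAlg.family C ⊔ LevelAlg.family C') d =
            LevelAlg.hilb (LevelAlg.family C) d + LevelAlg.hilb (LevelAlg.family C') d := by
  suffices h : ∃ (U : Set (LevelAlg.CoeffIdx D.r D.j D.P D.s → k))
      (U' : Set (LevelAlg.CoeffIdx D.r D.j D.Q D.u → k)),
      LevelAlg.IsDenseZariskiOpen U ∧ LevelAlg.IsDenseZariskiOpen U' ∧
      ∀ C ∈ U, ∀ C' ∈ U',
        LevelAlg.family C ⊓ LevelAlg.family C' = ⊥ ∧
        ∀ d : ℕ, D.i ≤ d →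
          LevelAlg.hilb (LevelAlg.family C ⊔ LevelAlg.family C') d =
            LevelAlg.hilb (LevelAlg.family C) d + LevelAlg.hilb (LevelAlg.family C') d by
    obtain ⟨U, U', hU, hU', h⟩ := h
    exact ⟨U, U', hU, hU', fun C hC C' hC' =>
      ⟨(h C hC C' hC').1, fun d hd _ => (h C hC C' hC').2 d hd⟩⟩
  cases hD with
  | F₁ a i s ha hi _ => exact LevelAlg.exists_dense_F₁ ha hi
  | F₂ a i s ha hodd hi _ => exact LevelAlg.exists_dense_F₂ ha hodd hi
  | G₁ a b i s ha hab hi _ => exact LevelAlg.exists_dense_G₁ ha hab hi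
  | G₂ a b i s ha hab heven hi _ => exact LevelAlg.exists_dense_G₂ ha hab heven hi
  | G₃ a b m i s _ ha hab _ hi hineq _ => exact LevelAlg.exists_dense_G₃ ha hab hi hineq
  | H₁ a b c i s ha hab hbc hi _ => exact LevelAlg.exists_dense_H₁ ha hab hbc hi
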